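/- Let $(V,E)$ be a finite directed multigraph that is strongly connected (for all $u,v\in V$ there is a directed path from $u$ to $v$), and write $E_{uv}$ for the set of edges from $u$ to $v$. For each $v\in V$ let $S_v$ be a complete metric space with at least two points, and for each $e\in E_{uv}$ let $f_e\colon S_v\to S_u$ be a map satisfying $$ r'_e\, d(x,y)\;\le\; d\big(f_e(x),f_e(y)\big)\;\le\; r_e\, d(x,y)\qquad\text{for all } x,y\in S_v, $$ where $r'_e>0$ and $r_e<1$. Let $(K_v)_{v\in V}$ be the attractor list, i.e. nonempty compact sets $K_v\subseteq S_v$ with $K_u=\bigcup_{v\in V}\bigcup_{e\in E_{uv}} f_e[K_v]$ for all $u\in V$. Suppose the strong open set condition holds: there are open sets $U_v\subseteq S_v$ such that (a) $f_e[U_v]\subseteq U_u$ for all $u,v\in V$ and $e\in E_{uv}$; (b) $f_e[U_v]\cap f_{e'}[U_{v'}]=\varnothing$ for all $u,v,v'\in V$, $e\in E_{uv}$, $e'\in E_{uv'}$ with $e\ne e'$; (c) $U_v\cap K_v\ne\varnothing$ for all $v\in V$. For $s\ge 0$ let $M'(s)$ be the $V\times V$ matrix with entries $M'_{uv}(s)=\sum_{e\in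 E_{uv}} (r'_e)^s$, let $\rho$ denote the spectral radius (the maximum absolute value of the complex eigenvalues), and let $s_2\ge 0$ be the dimension of the Mauldin–Williams graph $(V,E,(r'_e))$, i.e. the solution of $\rho(M'(s_2))=1$. Then the Hausdorff dimensions of the attractors satisfy $$ \dim_{\mathrm H} K_v\ge s_2\qquad\text{for all } v\in V. $$ -/

import Mathlib

/-!
Graph-directed iterated function systems. The directed multigraph is a `Quiver` on `V`: the type
`u ⟶ v` is the set `E_{uv}` of edges from `u` to `v`, and the map attached to an edge
`e : u ⟶ v` goes from the space `S v` to the space `S u`.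
-/

namespace GraphIFS

universe u w x

/-- The matrix `M(s)` of a Mauldin–Williams graph with ratios `r`:
its `(u, v)` entry is the sum of `r_e ^ s` over the edges `e` from `u` to `v`. -/
noncomputable def mwMatrix {V : Type u} [Quiver.{w} V] [∀ a b : V, Fintype (a ⟶ b)]
    (r : ∀ ⦃a b : V⦄, (a ⟶ b) → ℝ) (s : ℝ) : Matrix V V ℝ :=
  Matrix.of fun a b => ∑ e : (a ⟶ b), r e ^ s

/-- `Φ(s) = ρ(M(s))`, the maximum absolute value of the complex eigenvalues of `M(s)`. -/
noncomputable def mwRadius {V : Type u} [Fintype V] [DecidableEq V] [Quiver.{w} V]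
    [∀ a b : V, Fintype (a ⟶ b)] (r : ∀ ⦃a b : V⦄, (a ⟶ b) → ℝ) (s : ℝ) : ENNReal :=
  spectralRadius ℂ ((mwMatrix r s).map (fun t : ℝ => (t : ℂ)))

/-- `s` is the dimension of the Mauldin–Williams graph with ratios `r`:
it is the solution `s ≥ 0` of `ρ(M(s)) = 1`. -/
def IsMWDimension {V : Type u} [Fintype V] [DecidableEq V] [Quiver.{w} V]
    [∀ a b : V, Fintype (a ⟶ b)] (r : ∀ ⦃a b : V⦄, (a ⟶ b) → ℝ) (s : ℝ) : Prop :=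
  0 ≤ s ∧ mwRadius r s = 1

/-- `K` is the attractor list of the system `f`: nonempty compact sets with
`K_a = ⋃_b ⋃_{e ∈ E_{ab}} f_e[K_b]` for every vertex `a`. -/
structure IsAttractorList {V : Type u} [Quiver.{w} V] {S : V → Type x}
    [∀ v, MetricSpace (S v)] (f : ∀ ⦃a b : V⦄, (a ⟶ b) → S b → S a)
    (K : ∀ v, Set (S v)) : Prop where
  nonempty : ∀ v, (K v).Nonempty
  isCompact : ∀ v, IsCompact (K v)
  invariant : ∀ a, K a = ⋃ b : V, ⋃ e : (a ⟶ b), f e '' K b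

/-- The strong open set condition for the system `f` with attractor list `K`. Two edges leaving
the same vertex `a`, with possibly different terminal vertices, are compared as elements of
`Σ b, (a ⟶ b)`. -/
def StrongOpenSetCondition {V : Type u} [Quiver.{w} V] {S : V → Type x}
    [∀ v, MetricSpace (S v)] (f : ∀ ⦃a b : V⦄, (a ⟶ b) → S b → S a)
    (K : ∀ v, Set (S v)) : Prop :=
  ∃ U : ∀ v, Set (S v),
    (∀ v, IsOpen (U v)) ∧
    (∀ (a b : V) (e : a ⟶ b), f e '' U b ⊆ U a) ∧
    (∀ (a b b' : V) (e : a ⟶ b) (e' : a ⟶ b'),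
      (⟨b, e⟩ : Σ c : V, (a ⟶ c)) ≠ ⟨b', e'⟩ → Disjoint (f e '' U b) (f e' '' U b')) ∧
    (∀ v, (U v ∩ K v).Nonempty)

end GraphIFS

/-!
Fix `v` and `0 < s < s₂`. Since `ρ(M'(s₂)) = 1`, the entries of `M'(s₂)ⁿ` have sum at least `1`.
Passing from exponent `s₂` to `s` multiplies every entry of `M'` by at least some `c > 1`, so some
entry `(a, b)` of `M'(s)ⁿ`, which is the sum of `r'_p ^ s` over the paths `p : a → b` of length
`n`, is unbounded in `n`. Strong connectedness provides a path `P` from `v` to `a` and, thanks to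
the points of `K_b` in `U_b`, a path `Q` from `b` to `v` with `f_Q[K_v] ⊆ U_b`. The loops `P p Q`
then map `K_v` to pairwise disjoint subsets of `K_v`, and for large `n` their ratios satisfy
`∑ r'_{PpQ} ^ s > 1`.

Such a family of maps forces `dim_H K_v ≥ s`: the images of `K_v` are `δ`-separated for some `δ`,
and every finite cover of `K_v` has `∑ (diam A_j) ^ s ≥ δ ^ s`. Indeed, if all `A_j` have diameter
below `δ`, each `A_j` meets at most one image, so pulling the pieces that meet the `i`-th image back
to `K_v` produces a cover with fewer pieces, and induction applies.
-/

open scoped ENNReal NNReal Topology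
open Metric Set Filter Quiver

open Classical in
theorem subset_biUnion_filter_preimage_inter {X Y κ : Type*} {g : X → Y} {K : Set X} {L : Set Y}
    (hg : MapsTo g K L) {J : Finset κ} {B : κ → Set Y} (hB : L ⊆ ⋃ j ∈ J, B j) :
    K ⊆ ⋃ j ∈ {j ∈ J | (B j ∩ g '' K).Nonempty}, g ⁻¹' B j ∩ K := by
  intro x hx
  obtain ⟨j, hj, hxj⟩ := mem_iUnion₂.1 (hB (hg hx))
  exact mem_iUnion₂.2 ⟨j, Finset.mem_filter.2 ⟨hj, g x, hxj, mem_image_of_mem g hx⟩, hxj, hx⟩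

section Covering

variable {X ι κ : Type*} [PseudoEMetricSpace X] {K : Set X} {A : κ → Set X} {δ : ℝ≥0∞}

theorem mul_ediam_preimage_inter_le {Y : Type*} [PseudoEMetricSpace Y] {g : X → Y} {ρ : ℝ≥0∞}
    (hg : ∀ x ∈ K, ∀ y ∈ K, ρ * edist x y ≤ edist (g x) (g y)) (B : Set Y) :
    ρ * ediam (g ⁻¹' B ∩ K) ≤ ediam B := by
  simp only [ediam, ENNReal.mul_iSup]
  exact iSup₂_le fun x hx => iSup₂_le fun y hy =>
    (hg x hx.2 y hy.2).trans (edist_le_ediam_of_mem hx.1 hy.1)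

open Classical in
theorem pairwise_disjoint_filter_of_ediam_lt {J : Finset κ} (hA : ∀ j ∈ J, ediam (A j) < δ)
    {C : ι → Set X} (hC : Pairwise fun i i' => ∀ x ∈ C i, ∀ y ∈ C i', δ ≤ edist x y) :
    Pairwise fun i i' =>
      Disjoint {j ∈ J | (A j ∩ C i).Nonempty} {j ∈ J | (A j ∩ C i').Nonempty} := by
  intro i i' hne
  refine Finset.disjoint_left.2 fun j hj hj' => ?_
  obtain ⟨hjJ, x, hxA, hxC⟩ := Finset.mem_filter.1 hj
  obtain ⟨-, y, hyA, hyC⟩ := Finset.mem_filter.1 hj'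
  exact (hA j hjJ).not_ge ((hC hne x hxC y hyC).trans (edist_le_ediam_of_mem hxA hyA))

variable [Fintype ι] [Nontrivial ι] {g : ι → X → X} {s : ℝ}

open Classical in
theorem rpow_le_sum_ediam_rpow {ρ : ι → ℝ≥0∞} (hs : 0 ≤ s) (hK : K.Nonempty)
    (hmaps : ∀ i, MapsTo (g i) K K)
    (hexp : ∀ i, ∀ x ∈ K, ∀ y ∈ K, ρ i * edist x y ≤ edist (g i x) (g i y))
    (hsep : Pairwise fun i i' => ∀ x ∈ g i '' K, ∀ y ∈ g i' '' K, δ ≤ edist x y)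
    (hsum : 1 ≤ ∑ i, ρ i ^ s) (J : Finset κ) (hA : K ⊆ ⋃ j ∈ J, A j) :
    δ ^ s ≤ ∑ j ∈ J, ediam (A j) ^ s := by
  induction J using Finset.strongInduction generalizing A with | H J ih => ?_
  by_cases! hbig : ∃ j ∈ J, δ ≤ ediam (A j)
  · obtain ⟨j, hj, hδ⟩ := hbig
    exact (ENNReal.rpow_le_rpow hδ hs).trans
      (Finset.single_le_sum (f := fun j => ediam (A j) ^ s) (fun _ _ => zero_le) hj)
  let T : ι → Finset κ := fun i => {j ∈ J | (A j ∩ g i '' K).Nonempty}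
  have hdisj : Pairwise fun i i' => Disjoint (T i) (T i') :=
    pairwise_disjoint_filter_of_ediam_lt hbig hsep
  have hcover (i : ι) : K ⊆ ⋃ j ∈ T i, g i ⁻¹' A j ∩ K :=
    subset_biUnion_filter_preimage_inter (hmaps i) hA
  have hT_nonempty (i : ι) : (T i).Nonempty := by
    obtain ⟨j, hj, -⟩ := mem_iUnion₂.1 (hcover i hK.some_mem)
    exact ⟨j, hj⟩
  have hT_ssubset (i : ι) : T i ⊂ J := by
    obtain ⟨i', hi'⟩ := exists_ne i
    obtain ⟨j, hj⟩ := hT_nonempty i'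
    exact (Finset.ssubset_iff_of_subset (Finset.filter_subset _ _)).2
      ⟨j, Finset.mem_of_mem_filter j hj, Finset.disjoint_left.1 (hdisj hi') hj⟩
  have hstep (i : ι) : ρ i ^ s * δ ^ s ≤ ∑ j ∈ T i, ediam (A j) ^ s :=
    calc ρ i ^ s * δ ^ s ≤ ρ i ^ s * ∑ j ∈ T i, ediam (g i ⁻¹' A j ∩ K) ^ s :=
          mul_le_mul_right (ih _ (hT_ssubset i) (hcover i)) _
      _ = ∑ j ∈ T i, (ρ i * ediam (g i ⁻¹' A j ∩ K)) ^ s := by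
          simp only [Finset.mul_sum, ENNReal.mul_rpow_of_nonneg _ _ hs]
      _ ≤ ∑ j ∈ T i, ediam (A j) ^ s := Finset.sum_le_sum fun j _ =>
          ENNReal.rpow_le_rpow (mul_ediam_preimage_inter_le (hexp i) (A j)) hs
  calc δ ^ s ≤ (∑ i, ρ i ^ s) * δ ^ s := le_mul_of_one_le_left zero_le hsum
    _ = ∑ i, ρ i ^ s * δ ^ s := Finset.sum_mul _ _ _
    _ ≤ ∑ i, ∑ j ∈ T i, ediam (A j) ^ s := Finset.sum_le_sum fun i _ => hstep i
    _ = ∑ j ∈ Finset.univ.biUnion T, ediam (A j) ^ s :=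
        (Finset.sum_biUnion fun i _ i' _ hne => hdisj hne).symm
    _ ≤ ∑ j ∈ J, ediam (A j) ^ s :=
        Finset.sum_le_sum_of_subset (Finset.biUnion_subset.2 fun i _ => (hT_ssubset i).subset)

end Covering

theorem exists_isOpen_ediam_rpow_le {X : Type*} [PseudoEMetricSpace X] (t : Set X) {s : ℝ}
    (hs : 0 < s) {η : ℝ≥0∞} (hη : η ≠ 0) :
    ∃ O, IsOpen O ∧ t ⊆ O ∧ ediam O ^ s ≤ ediam t ^ s + η := by
  by_cases htop : ediam t = ∞
  · exact ⟨univ, isOpen_univ, subset_univ t, by simp [htop, ENNReal.top_rpow_of_pos hs]⟩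
  have hcont : Continuous fun ε : ℝ≥0 => (ediam t + 2 * (ε : ℝ≥0∞)) ^ s :=
    ENNReal.continuous_rpow_const.comp <| continuous_const.add <|
      (ENNReal.continuous_const_mul ENNReal.ofNat_ne_top).comp ENNReal.continuous_coe
  have hlim : Tendsto (fun ε : ℝ≥0 => (ediam t + 2 * (ε : ℝ≥0∞)) ^ s) (𝓝[>] 0)
      (𝓝 (ediam t ^ s)) := by
    simpa using (hcont.tendsto 0).mono_left nhdsWithin_le_nhds
  have hlt : ediam t ^ s < ediam t ^ s + η :=
    ENNReal.lt_add_right (ENNReal.rpow_ne_top_of_nonneg hs.le htop) hη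
  obtain ⟨ε, hε, hε0⟩ := ((hlim.eventually_lt_const hlt).and self_mem_nhdsWithin).exists
  exact ⟨thickening ε t, isOpen_thickening, self_subset_thickening (NNReal.coe_pos.2 hε0) t,
    (ENNReal.rpow_le_rpow (ediam_thickening_le ε) hs.le).trans hε.le⟩

theorem le_hausdorffMeasure_of_forall_finset_cover {X : Type*} [EMetricSpace X]
    [MeasurableSpace X] [BorelSpace X] {K : Set X} (hK : IsCompact K) {s : ℝ} (hs : 0 < s)
    {c : ℝ≥0∞} (h : ∀ (J : Finset ℕ) (A : ℕ → Set X), K ⊆ ⋃ j ∈ J, A j →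
      c ≤ ∑ j ∈ J, ediam (A j) ^ s) :
    c ≤ MeasureTheory.Measure.hausdorffMeasure s K := by
  rw [MeasureTheory.Measure.hausdorffMeasure_apply]
  refine le_iSup₂_of_le 1 one_pos (le_iInf₂ fun t ht => le_iInf fun _ => ?_)
  refine ENNReal.le_of_forall_pos_le_add fun ε hε _ => ?_
  obtain ⟨η, hη, hηsum⟩ :=
    ENNReal.exists_pos_sum_of_countable' (ENNReal.coe_pos.2 hε).ne' ℕ
  choose O hO htO hdiam using fun n => exists_isOpen_ediam_rpow_le (t n) hs (hη n).ne'
  obtain ⟨J, hJ⟩ := hK.elim_finite_subcover O hO (ht.trans (iUnion_mono htO))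
  have hterm (n : ℕ) : ediam (t n) ^ s ≤ ⨆ _ : (t n).Nonempty, ediam (t n) ^ s := by
    rcases (t n).eq_empty_or_nonempty with hempty | hne
    · simp [hempty, ENNReal.zero_rpow_of_pos hs]
    · simp [hne]
  calc c ≤ ∑ j ∈ J, ediam (O j) ^ s := h J O hJ
    _ ≤ ∑ j ∈ J, ((⨆ _ : (t j).Nonempty, ediam (t j) ^ s) + η j) :=
        Finset.sum_le_sum fun j _ => (hdiam j).trans (add_le_add_left (hterm j) _)
    _ ≤ ∑' j, ((⨆ _ : (t j).Nonempty, ediam (t j) ^ s) + η j) := ENNReal.sum_le_tsum J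
    _ = (∑' j, ⨆ _ : (t j).Nonempty, ediam (t j) ^ s) + ∑' j, η j := ENNReal.tsum_add
    _ ≤ (∑' j, ⨆ _ : (t j).Nonempty, ediam (t j) ^ s) + ε := add_le_add_right hηsum.le _

theorem exists_pos_pairwise_forall_le_edist {X ι : Type*} [EMetricSpace X] [Finite ι]
    {C : ι → Set X} (hC : ∀ i, IsCompact (C i)) (hdisj : Pairwise fun i j => Disjoint (C i) (C j)) :
    ∃ δ : ℝ≥0, 0 < δ ∧ Pairwise fun i j => ∀ x ∈ C i, ∀ y ∈ C j, (δ : ℝ≥0∞) ≤ edist x y := by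
  have hev : ∀ᶠ δ : ℝ≥0 in 𝓝[>] 0,
      ∀ i j, i ≠ j → ∀ x ∈ C i, ∀ y ∈ C j, (δ : ℝ≥0∞) ≤ edist x y := by
    refine eventually_all.2 fun i => eventually_all.2 fun j => eventually_imp_distrib_left.2 ?_
    intro hij
    obtain ⟨ε, hε, hlt⟩ := exists_pos_forall_lt_edist (hC i) (hC j).isClosed (hdisj hij)
    filter_upwards [Ioo_mem_nhdsGT hε] with δ hδ x hx y hy
    exact (ENNReal.coe_le_coe.2 hδ.2.le).trans (hlt x hx y hy).le
  obtain ⟨δ, hsep, hδ⟩ := (hev.and self_mem_nhdsWithin).exists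
  exact ⟨δ, hδ, hsep⟩

theorem le_dimH_of_pairwise_disjoint_image {X ι : Type*} [MetricSpace X] [Fintype ι]
    [Nontrivial ι] {K : Set X} (hK : IsCompact K) (hne : K.Nonempty) {g : ι → X → X} {ρ : ι → ℝ}
    {s : ℝ≥0} (hcont : ∀ i, ContinuousOn (g i) K) (hmaps : ∀ i, MapsTo (g i) K K)
    (hρ : ∀ i, 0 ≤ ρ i) (hexp : ∀ i, ∀ x ∈ K, ∀ y ∈ K, ρ i * dist x y ≤ dist (g i x) (g i y))
    (hdisj : Pairwise fun i j => Disjoint (g i '' K) (g j '' K))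
    (hsum : 1 ≤ ∑ i, ρ i ^ (s : ℝ)) : (s : ℝ≥0∞) ≤ dimH K := by
  rcases eq_zero_or_pos s with rfl | hs
  · exact zero_le
  have hs' : (0 : ℝ) < s := hs
  obtain ⟨δ, hδ, hsep⟩ :=
    exists_pos_pairwise_forall_le_edist (fun i => hK.image_of_continuousOn (hcont i)) hdisj
  have hexp' (i : ι) (x) (hx : x ∈ K) (y) (hy : y ∈ K) :
      ENNReal.ofReal (ρ i) * edist x y ≤ edist (g i x) (g i y) := by
    rw [edist_dist, edist_dist, ← ENNReal.ofReal_mul (hρ i)]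
    exact ENNReal.ofReal_le_ofReal (hexp i x hx y hy)
  have hsum' : 1 ≤ ∑ i, ENNReal.ofReal (ρ i) ^ (s : ℝ) := by
    simp only [ENNReal.ofReal_rpow_of_nonneg (hρ _) hs'.le]
    rw [← ENNReal.ofReal_sum_of_nonneg fun i _ => Real.rpow_nonneg (hρ i) _]
    exact ENNReal.one_le_ofReal.2 hsum
  borelize X
  have hδs : (δ : ℝ≥0∞) ^ (s : ℝ) ≤ MeasureTheory.Measure.hausdorffMeasure s K :=
    le_hausdorffMeasure_of_forall_finset_cover hK hs' fun J _ hA =>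
      rpow_le_sum_ediam_rpow hs'.le hne hmaps hexp' hsep hsum' J hA
  have hδs0 : 0 < (δ : ℝ≥0∞) ^ (s : ℝ) :=
    ENNReal.rpow_pos (ENNReal.coe_pos.2 hδ) ENNReal.coe_ne_top
  exact le_dimH_of_hausdorffMeasure_ne_zero (hδs0.trans_le hδs).ne'

theorem injective_of_mul_dist_le {X Y : Type*} [MetricSpace X] [PseudoMetricSpace Y] {g : X → Y}
    {ρ : ℝ} (hρ : 0 < ρ) (hg : ∀ x y, ρ * dist x y ≤ dist (g x) (g y)) : g.Injective := by
  intro x y hxy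
  have hle := hg x y
  rw [hxy, dist_self] at hle
  exact dist_le_zero.1 (nonpos_of_mul_nonpos_right hle hρ)

theorem nontrivial_of_one_lt_sum {ι : Type*} [Fintype ι] {x : ι → ℝ} (hx : ∀ i, x i ≤ 1)
    (hsum : 1 < ∑ i, x i) : Nontrivial ι := by
  have hcard : ∑ i, x i ≤ Fintype.card ι := by
    simpa using Finset.sum_le_card_nsmul Finset.univ x 1 fun i _ => hx i
  exact Fintype.one_lt_card_iff_nontrivial.1 (by exact_mod_cast hsum.trans_le hcard)

section NonnegativeMatrix

variable {V : Type*} [Fintype V] [DecidableEq V]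

open scoped Matrix.Norms.Operator in
theorem one_le_sum_abs_pow_apply_of_one_le_spectralRadius [Nonempty V] {M : Matrix V V ℝ}
    (hM : 1 ≤ spectralRadius ℂ (M.map fun t : ℝ => (t : ℂ))) (n : ℕ) :
    1 ≤ ∑ a, ∑ b, |(M ^ n) a b| := by
  have : CompleteSpace (Matrix V V ℂ) := FiniteDimensional.complete ℂ _
  set A : Matrix V V ℂ := M.map fun t : ℝ => (t : ℂ)
  have hpow : A ^ n = (M ^ n).map Complex.ofRealHom :=
    (Matrix.map_pow M Complex.ofRealHom n).symm
  have hnorm : 1 ≤ ‖A ^ n‖₊ := ENNReal.one_le_coe_iff.1 <|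
    calc (1 : ℝ≥0∞) ≤ spectralRadius ℂ A ^ n := one_le_pow₀ hM
      _ ≤ spectralRadius ℂ (A ^ n) := spectrum.spectralRadius_pow_le' A n
      _ ≤ ‖A ^ n‖₊ := spectrum.spectralRadius_le_nnnorm (A ^ n)
  have hsum : ‖A ^ n‖₊ ≤ ∑ a, ∑ b, ‖(A ^ n) a b‖₊ := by
    rw [Matrix.linfty_opNNNorm_def]
    exact Finset.sup_le fun a _ => Finset.single_le_sum
      (f := fun a => ∑ b, ‖(A ^ n) a b‖₊) (fun _ _ => zero_le) (Finset.mem_univ a)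
  simpa [hpow] using NNReal.coe_le_coe.2 (hnorm.trans hsum)

theorem pow_apply_nonneg {A : Matrix V V ℝ} (hA : ∀ a b, 0 ≤ A a b) (n : ℕ) (a b : V) :
    0 ≤ (A ^ n) a b := by
  induction n generalizing b with
  | zero => rw [pow_zero, Matrix.one_apply]; positivity
  | succ n ih =>
    rw [pow_succ, Matrix.mul_apply]
    exact Finset.sum_nonneg fun c _ => mul_nonneg (ih c) (hA c b)

theorem pow_mul_pow_apply_le {A B : Matrix V V ℝ} (hA : ∀ a b, 0 ≤ A a b) {c : ℝ} (hc : 0 ≤ c)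
    (hAB : ∀ a b, c * A a b ≤ B a b) (n : ℕ) (a b : V) :
    c ^ n * (A ^ n) a b ≤ (B ^ n) a b := by
  induction n generalizing b with
  | zero => simp
  | succ n ih =>
    have hcA (d : V) : 0 ≤ c * A d b := mul_nonneg hc (hA d b)
    have hcAn (d : V) : 0 ≤ c ^ n * (A ^ n) a d :=
      mul_nonneg (pow_nonneg hc n) (pow_apply_nonneg hA n a d)
    simp only [pow_succ, Matrix.mul_apply, Finset.mul_sum]
    refine Finset.sum_le_sum fun d _ => ?_
    calc c ^ n * c * ((A ^ n) a d * A d b) = (c ^ n * (A ^ n) a d) * (c * A d b) := by ring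
      _ ≤ (B ^ n) a d * B d b :=
          mul_le_mul (ih d) (hAB d b) (hcA d) ((hcAn d).trans (ih d))

theorem exists_forall_exists_lt_pow_apply [Nonempty V] {A B : Matrix V V ℝ}
    (hA : ∀ a b, 0 ≤ A a b) (hρ : 1 ≤ spectralRadius ℂ (A.map fun t : ℝ => (t : ℂ)))
    {c : ℝ} (hc : 1 < c) (hAB : ∀ a b, c * A a b ≤ B a b) :
    ∃ a b, ∀ C : ℝ, ∃ n : ℕ, C < (B ^ n) a b := by
  by_contra! hbdd
  choose C hC using hbdd
  obtain ⟨n, hn⟩ := pow_unbounded_of_one_lt (∑ a, ∑ b, C a b) hc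
  refine hn.not_ge ?_
  calc c ^ n ≤ c ^ n * ∑ a, ∑ b, |(A ^ n) a b| :=
        le_mul_of_one_le_right (by positivity)
          (one_le_sum_abs_pow_apply_of_one_le_spectralRadius hρ n)
    _ = ∑ a, ∑ b, c ^ n * (A ^ n) a b := by
        simp only [Finset.mul_sum, abs_of_nonneg (pow_apply_nonneg hA n _ _)]
    _ ≤ ∑ a, ∑ b, C a b := Finset.sum_le_sum fun a _ => Finset.sum_le_sum fun b _ =>
        (pow_mul_pow_apply_le hA (by positivity) hAB n a b).trans (hC a b n)

end NonnegativeMatrix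

namespace GraphIFS

section PathFinset

variable {V : Type*} [Quiver V]

/-- Appending a last edge, as an embedding into the paths from `a` to `b`. -/
def consEmbedding (a b : V) : (Σ c : V, Path a c × (c ⟶ b)) ↪ Path a b where
  toFun q := q.2.1.cons q.2.2
  inj' := by
    rintro ⟨c, p, e⟩ ⟨c', p', e'⟩ h
    cases h
    rfl

variable [Fintype V] [DecidableEq V] [∀ a b : V, Fintype (a ⟶ b)]

/-- The paths of length `n` from `a` to `b`. -/
def pathFinset (a : V) : ℕ → ∀ b : V, Finset (Path a b)
  | 0, b => if h : a = b then {h ▸ Path.nil} else ∅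
  | n + 1, b =>
    (Finset.univ.sigma fun c => pathFinset a n c ×ˢ Finset.univ).map (consEmbedding a b)

theorem length_of_mem_pathFinset {n : ℕ} {a b : V} {p : Path a b} (hp : p ∈ pathFinset a n b) :
    p.length = n := by
  induction n generalizing b with
  | zero =>
    by_cases hab : a = b
    · subst hab
      simp_all [pathFinset]
    · simp [pathFinset, hab] at hp
  | succ n ih =>
    obtain ⟨⟨c, q, e⟩, hq, rfl⟩ := Finset.mem_map.1 hp
    exact congrArg (· + 1) (ih (Finset.mem_product.1 (Finset.mem_sigma.1 hq).2).1)

theorem sum_weight_pathFinset {R : Type*} [Semiring R] (w : ∀ {a b : V}, (a ⟶ b) → R) (n : ℕ)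
    (a b : V) :
    ∑ p ∈ pathFinset a n b, p.weight w =
      ((Matrix.of fun a b => ∑ e : (a ⟶ b), w e : Matrix V V R) ^ n) a b := by
  induction n generalizing b with
  | zero =>
    by_cases hab : a = b
    · subst hab
      simp [pathFinset]
    · simp [pathFinset, hab]
  | succ n ih =>
    rw [pathFinset, Finset.sum_map, Finset.sum_sigma, pow_succ, Matrix.mul_apply]
    refine Finset.sum_congr rfl fun c _ => ?_
    rw [← ih, Matrix.of_apply, Finset.sum_mul_sum, Finset.sum_product]
    exact Finset.sum_congr rfl fun p _ => Finset.sum_congr rfl fun e _ => Path.weight_cons w p e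

end PathFinset

section PathRatio

variable {V : Type*} [Quiver V] {r : ∀ ⦃a b : V⦄, (a ⟶ b) → ℝ}

/-- The product `r_{e₁} ⋯ r_{eₙ}` of the ratios along a path. -/
abbrev pathRatio (r : ∀ ⦃a b : V⦄, (a ⟶ b) → ℝ) {a b : V} (p : Path a b) : ℝ :=
  p.weight fun e => r e

theorem pathRatio_cons {a b c : V} (p : Path a b) (e : b ⟶ c) :
    pathRatio r (p.cons e) = pathRatio r p * r e :=
  Path.weight_cons _ p e

theorem pathRatio_comp {a b c : V} (p : Path a b) (q : Path b c) :
    pathRatio r (p.comp q) = pathRatio r p * pathRatio r q :=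
  Path.weight_comp _ p q

theorem pathRatio_nonneg (hr : ∀ (a b : V) (e : a ⟶ b), 0 ≤ r e) {a b : V} (p : Path a b) :
    0 ≤ pathRatio r p :=
  Path.weight_nonneg (fun e => hr _ _ e) p

theorem pathRatio_pos (hr : ∀ (a b : V) (e : a ⟶ b), 0 < r e) {a b : V} (p : Path a b) :
    0 < pathRatio r p :=
  Path.weight_pos (fun e => hr _ _ e) p

theorem pathRatio_le_one (hr : ∀ (a b : V) (e : a ⟶ b), 0 ≤ r e)
    (hr1 : ∀ (a b : V) (e : a ⟶ b), r e ≤ 1) {a b : V} (p : Path a b) : pathRatio r p ≤ 1 := by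
  induction p with
  | nil => exact (Path.weight_nil _ a).le
  | cons p e ih => exact (pathRatio_cons p e).trans_le (mul_le_one₀ ih (hr _ _ e) (hr1 _ _ e))

theorem weight_rpow_eq_pathRatio_rpow (hr : ∀ (a b : V) (e : a ⟶ b), 0 ≤ r e) (s : ℝ) {a b : V}
    (p : Path a b) : (p.weight fun e => r e ^ s) = pathRatio r p ^ s := by
  induction p with
  | nil => simp
  | cons p e ih =>
    rw [Path.weight_cons, pathRatio_cons, ih, Real.mul_rpow (pathRatio_nonneg hr p) (hr _ _ e)]

theorem exists_lt_one_forall_ratio_le [Finite V] [∀ a b : V, Finite (a ⟶ b)]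
    (hr : ∀ (a b : V) (e : a ⟶ b), r e < 1) :
    ∃ R : ℝ≥0, 0 < R ∧ R < 1 ∧ ∀ (a b : V) (e : a ⟶ b), r e ≤ R := by
  have hev : ∀ᶠ R : ℝ in 𝓝[<] 1, ∀ (a b : V) (e : a ⟶ b), r e ≤ R :=
    eventually_all.2 fun a => eventually_all.2 fun b => eventually_all.2 fun e =>
      (eventually_ge_nhds (hr a b e)).filter_mono nhdsWithin_le_nhds
  obtain ⟨R, hR, hR0, hR1⟩ := (hev.and (Ioo_mem_nhdsLT one_pos)).exists
  exact ⟨⟨R, hR0.le⟩, hR0, hR1, hR⟩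

variable [∀ a b : V, Fintype (a ⟶ b)]

theorem rpow_sub_mul_mwMatrix_le (hr : ∀ (a b : V) (e : a ⟶ b), 0 < r e) {R : ℝ}
    (hrR : ∀ (a b : V) (e : a ⟶ b), r e ≤ R) {s t : ℝ} (hst : s ≤ t) (a b : V) :
    R ^ (s - t) * mwMatrix r t a b ≤ mwMatrix r s a b := by
  simp only [mwMatrix, Matrix.of_apply, Finset.mul_sum]
  refine Finset.sum_le_sum fun e _ => ?_
  have he := hr a b e
  calc R ^ (s - t) * r e ^ t ≤ r e ^ (s - t) * r e ^ t := by
        gcongr ?_ * _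
        exact Real.rpow_le_rpow_of_nonpos he (hrR a b e) (sub_nonpos.2 hst)
    _ = r e ^ s := by rw [← Real.rpow_add he, sub_add_cancel]

variable [Fintype V] [DecidableEq V]

theorem sum_pathRatio_rpow_pathFinset (hr : ∀ (a b : V) (e : a ⟶ b), 0 ≤ r e) (s : ℝ) (n : ℕ)
    (a b : V) : ∑ p ∈ pathFinset a n b, pathRatio r p ^ s = (mwMatrix r s ^ n) a b := by
  simp only [← weight_rpow_eq_pathRatio_rpow hr s]
  exact sum_weight_pathFinset _ n a b

theorem sum_pathRatio_comp_rpow (hr : ∀ (a b : V) (e : a ⟶ b), 0 ≤ r e) (s : ℝ) (n : ℕ)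
    {a b c d : V} (p : Path a b) (q : Path c d) :
    ∑ x ∈ pathFinset b n c, pathRatio r (p.comp (x.comp q)) ^ s =
      (pathRatio r p * pathRatio r q) ^ s * (mwMatrix r s ^ n) b c := by
  rw [← sum_pathRatio_rpow_pathFinset hr, Finset.mul_sum]
  refine Finset.sum_congr rfl fun x _ => ?_
  rw [pathRatio_comp, pathRatio_comp, mul_left_comm, mul_comm,
    Real.mul_rpow (mul_nonneg (pathRatio_nonneg hr p) (pathRatio_nonneg hr q))
      (pathRatio_nonneg hr x)]

theorem exists_forall_exists_lt_mwMatrix_pow [Nonempty V]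
    (hr : ∀ (a b : V) (e : a ⟶ b), 0 < r e) {R : ℝ} (hR0 : 0 < R) (hR1 : R < 1)
    (hrR : ∀ (a b : V) (e : a ⟶ b), r e ≤ R) {s t : ℝ} (ht : 1 ≤ mwRadius r t) (hst : s < t) :
    ∃ a b, ∀ C : ℝ, ∃ n : ℕ, C < (mwMatrix r s ^ n) a b :=
  exists_forall_exists_lt_pow_apply
    (fun a b => Finset.sum_nonneg fun e _ => Real.rpow_nonneg (hr a b e).le t) ht
    (Real.one_lt_rpow_of_pos_of_lt_one_of_neg hR0 hR1 (sub_neg.2 hst))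
    (rpow_sub_mul_mwMatrix_le hr hrR hst.le)

end PathRatio

section PathMap

variable {V : Type*} [Quiver V] {S : V → Type*}

/-- The composition `f_{e₁} ∘ ⋯ ∘ f_{eₙ}` of the maps along a path `e₁ ⋯ eₙ`. Like the maps of the
edges, it goes from the space of the terminal vertex to the space of the initial vertex. -/
def pathMap (f : ∀ ⦃a b : V⦄, (a ⟶ b) → S b → S a) {a : V} : ∀ {b : V}, Path a b → S b → S a
  | _, .nil => id
  | _, .cons p e => pathMap f p ∘ f e

variable {f : ∀ ⦃a b : V⦄, (a ⟶ b) → S b → S a}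

theorem pathMap_comp {a b c : V} (p : Path a b) (q : Path b c) :
    pathMap f (p.comp q) = pathMap f p ∘ pathMap f q := by
  induction q with
  | nil => rfl
  | cons q e ih => exact congrArg (· ∘ f e) ih

theorem mapsTo_pathMap {W : ∀ v, Set (S v)} (hW : ∀ (a b : V) (e : a ⟶ b), f e '' W b ⊆ W a)
    {a b : V} (p : Path a b) : MapsTo (pathMap f p) (W b) (W a) := by
  induction p with
  | nil => exact mapsTo_id _
  | cons p e ih => exact ih.comp (mapsTo_iff_image_subset.2 (hW _ _ e))

theorem injective_pathMap (hf : ∀ (a b : V) (e : a ⟶ b), (f e).Injective) {a b : V}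
    (p : Path a b) : (pathMap f p).Injective := by
  induction p with
  | nil => exact Function.injective_id
  | cons p e ih => exact ih.comp (hf _ _ e)

theorem disjoint_image_pathMap (hf : ∀ (a b : V) (e : a ⟶ b), (f e).Injective)
    {U : ∀ v, Set (S v)} (hU : ∀ (a b : V) (e : a ⟶ b), f e '' U b ⊆ U a)
    (hdisj : ∀ (a b b' : V) (e : a ⟶ b) (e' : a ⟶ b'),
      (⟨b, e⟩ : Σ c : V, (a ⟶ c)) ≠ ⟨b', e'⟩ → Disjoint (f e '' U b) (f e' '' U b'))
    {a b b' : V} (p : Path a b) (q : Path a b') (hlen : p.length = q.length)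
    (hpq : (⟨b, p⟩ : Σ c : V, Path a c) ≠ ⟨b', q⟩) :
    Disjoint (pathMap f p '' U b) (pathMap f q '' U b') := by
  induction p generalizing b' with
  | nil =>
    cases q with
    | nil => exact absurd rfl hpq
    | cons q e' => exact absurd hlen.symm (Nat.succ_ne_zero _)
  | cons p e ih =>
    cases q with
    | nil => exact absurd hlen (Nat.succ_ne_zero _)
    | cons q e' =>
      simp only [pathMap, image_comp]
      by_cases hinit : (⟨_, p⟩ : Σ c : V, Path a c) = ⟨_, q⟩
      · cases hinit
        refine (disjoint_image_iff (injective_pathMap hf p)).2 (hdisj _ _ _ e e' fun he => hpq ?_)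
        cases he
        rfl
      · exact (ih q (Nat.succ_injective hlen) hinit).mono
          (image_mono (hU _ _ e)) (image_mono (hU _ _ e'))

variable [∀ v, MetricSpace (S v)] {r : ∀ ⦃a b : V⦄, (a ⟶ b) → ℝ}

theorem pathRatio_mul_dist_le (hr : ∀ (a b : V) (e : a ⟶ b), 0 ≤ r e)
    (hlower : ∀ (a b : V) (e : a ⟶ b) (x y : S b), r e * dist x y ≤ dist (f e x) (f e y))
    {a b : V} (p : Path a b) (x y : S b) :
    pathRatio r p * dist x y ≤ dist (pathMap f p x) (pathMap f p y) := by
  induction p with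
  | nil => simp [pathMap]
  | cons p e ih =>
    rw [pathRatio_cons, mul_assoc]
    exact (mul_le_mul_of_nonneg_left (hlower _ _ e x y) (pathRatio_nonneg hr p)).trans (ih _ _)

theorem lipschitzWith_pathMap {R : ℝ≥0} (hf : ∀ (a b : V) (e : a ⟶ b), LipschitzWith R (f e))
    {a b : V} (p : Path a b) : LipschitzWith (R ^ p.length) (pathMap f p) := by
  induction p with
  | nil => exact LipschitzWith.id
  | cons p e ih =>
    rw [Path.length_cons, pow_succ]
    exact ih.comp (hf _ _ e)

end PathMap

section Attractor

variable {V : Type*} [Quiver V] {S : V → Type*} [∀ v, MetricSpace (S v)]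
  {f : ∀ ⦃a b : V⦄, (a ⟶ b) → S b → S a} {K : ∀ v, Set (S v)} {r : ∀ ⦃a b : V⦄, (a ⟶ b) → ℝ}
  {R : ℝ≥0}

theorem IsAttractorList.image_subset (hK : IsAttractorList f K) (a b : V) (e : a ⟶ b) :
    f e '' K b ⊆ K a := by
  rw [hK.invariant a]
  exact subset_iUnion₂ (s := fun b (e : a ⟶ b) => f e '' K b) b e

theorem IsAttractorList.exists_path_length_eq (hK : IsAttractorList f K) {a : V} {x : S a}
    (hx : x ∈ K a) (n : ℕ) :
    ∃ (b : V) (p : Path a b), p.length = n ∧ x ∈ pathMap f p '' K b := by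
  induction n with
  | zero => exact ⟨a, .nil, rfl, x, hx, rfl⟩
  | succ n ih =>
    obtain ⟨b, p, hp, y, hy, rfl⟩ := ih
    rw [hK.invariant b] at hy
    obtain ⟨c, e, z, hz, rfl⟩ := mem_iUnion₂.1 hy
    exact ⟨c, p.cons e, congrArg (· + 1) hp, z, hz, rfl⟩

theorem IsAttractorList.exists_path_mapsTo [Finite V] (hK : IsAttractorList f K)
    (hconn : IsStronglyConnected V) (hR : R < 1)
    (hf : ∀ (a b : V) (e : a ⟶ b), LipschitzWith R (f e)) {a : V} {O : Set (S a)} (hO : IsOpen O)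
    (hOK : (O ∩ K a).Nonempty) (v : V) : ∃ p : Path a v, MapsTo (pathMap f p) (K v) O := by
  obtain ⟨x, hxO, hxK⟩ := hOK
  obtain ⟨ε, hε, hball⟩ := Metric.isOpen_iff.1 hO x hxO
  obtain ⟨D, hD⟩ := Set.finite_range (fun v => diam (K v)) |>.bddAbove
  have hlim : Tendsto (fun n => (R : ℝ) ^ n * D) atTop (𝓝 0) := by
    simpa using (tendsto_pow_atTop_nhds_zero_of_lt_one R.coe_nonneg hR).mul_const D
  obtain ⟨n, hn⟩ := (hlim.eventually_lt_const hε).exists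
  obtain ⟨b, p, rfl, y, hy, rfl⟩ := hK.exists_path_length_eq hxK n
  obtain ⟨q⟩ := hconn b v
  refine ⟨p.comp q, fun z hz => hball ?_⟩
  have hqz : pathMap f q z ∈ K b := mapsTo_pathMap hK.image_subset q hz
  rw [pathMap_comp, mem_ball]
  calc dist (pathMap f p (pathMap f q z)) (pathMap f p y)
      ≤ R ^ p.length * dist (pathMap f q z) y := by
        exact_mod_cast (lipschitzWith_pathMap hf p).dist_le_mul _ _
    _ ≤ R ^ p.length * D := by
        gcongr
        exact (dist_le_diam_of_mem (hK.isCompact b).isBounded hqz hy).trans (hD ⟨b, rfl⟩)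
    _ < ε := hn

theorem IsAttractorList.le_dimH_of_one_lt_sum (hK : IsAttractorList f K)
    (hf : ∀ (a b : V) (e : a ⟶ b), LipschitzWith R (f e))
    (hr : ∀ (a b : V) (e : a ⟶ b), 0 ≤ r e) (hr1 : ∀ (a b : V) (e : a ⟶ b), r e ≤ 1)
    (hlower : ∀ (a b : V) (e : a ⟶ b) (x y : S b), r e * dist x y ≤ dist (f e x) (f e y))
    {v : V} {s : ℝ≥0} {ι : Type*} [Fintype ι] {loop : ι → Path v v}
    (hdisj : Pairwise fun i j =>
      Disjoint (pathMap f (loop i) '' K v) (pathMap f (loop j) '' K v))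
    (hsum : 1 < ∑ i, pathRatio r (loop i) ^ (s : ℝ)) : (s : ℝ≥0∞) ≤ dimH (K v) := by
  have hratio (i : ι) : 0 ≤ pathRatio r (loop i) := pathRatio_nonneg hr (loop i)
  have : Nontrivial ι := nontrivial_of_one_lt_sum
    (fun i => Real.rpow_le_one (hratio i) (pathRatio_le_one hr hr1 (loop i)) s.coe_nonneg) hsum
  exact le_dimH_of_pairwise_disjoint_image (hK.isCompact v) (hK.nonempty v)
    (fun i => (lipschitzWith_pathMap hf (loop i)).continuous.continuousOn)
    (fun i => mapsTo_pathMap hK.image_subset (loop i)) hratio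
    (fun i x _ y _ => pathRatio_mul_dist_le hr hlower (loop i) x y) hdisj hsum.le

theorem IsAttractorList.le_dimH_of_lt [Fintype V] [DecidableEq V] [∀ a b : V, Fintype (a ⟶ b)]
    (hK : IsAttractorList f K) (hU : StrongOpenSetCondition f K) (hconn : IsStronglyConnected V)
    (hR0 : 0 < R) (hR1 : R < 1) (hf : ∀ (a b : V) (e : a ⟶ b), LipschitzWith R (f e))
    (hr : ∀ (a b : V) (e : a ⟶ b), 0 < r e) (hrR : ∀ (a b : V) (e : a ⟶ b), r e ≤ R)
    (hlower : ∀ (a b : V) (e : a ⟶ b) (x y : S b), r e * dist x y ≤ dist (f e x) (f e y))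
    {t : ℝ} (ht : 1 ≤ mwRadius r t) {s : ℝ≥0} (hst : s < t) (v : V) :
    (s : ℝ≥0∞) ≤ dimH (K v) := by
  have : Nonempty V := ⟨v⟩
  have hr0 (a b : V) (e : a ⟶ b) : 0 ≤ r e := (hr a b e).le
  have hinj (a b : V) (e : a ⟶ b) : (f e).Injective :=
    injective_of_mul_dist_le (hr a b e) (hlower a b e)
  obtain ⟨U, hUopen, hUmaps, hUdisj, hUK⟩ := hU
  obtain ⟨a, b, hunbdd⟩ := exists_forall_exists_lt_mwMatrix_pow hr hR0 hR1 hrR ht hst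
  obtain ⟨P⟩ := hconn v a
  obtain ⟨Q, hQ⟩ := hK.exists_path_mapsTo hconn hR1 hf (hUopen b) (hUK b) v
  have hPQ : 0 < pathRatio r P * pathRatio r Q := mul_pos (pathRatio_pos hr P) (pathRatio_pos hr Q)
  obtain ⟨n, hn⟩ := hunbdd ((pathRatio r P * pathRatio r Q) ^ (s : ℝ))⁻¹
  have himage (p : Path a b) : pathMap f (P.comp (p.comp Q)) '' K v ⊆
      pathMap f P '' (pathMap f p '' U b) := by
    simp only [pathMap_comp, image_comp]
    exact image_mono (image_mono hQ.image_subset)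
  refine hK.le_dimH_of_one_lt_sum (ι := pathFinset a n b)
    (loop := fun p => P.comp (p.1.comp Q)) hf hr0
    (fun a b e => (hrR a b e).trans hR1.le) hlower (fun p q hpq => ?_) ?_
  · refine Disjoint.mono (himage p) (himage q) ?_
    refine (disjoint_image_iff (injective_pathMap hinj P)).2
      (disjoint_image_pathMap hinj hUmaps hUdisj p.1 q.1 ?_ fun h => hpq ?_)
    · rw [length_of_mem_pathFinset p.2, length_of_mem_pathFinset q.2]
    · exact Subtype.ext (eq_of_heq (Sigma.mk.inj h).2)
  · calc 1 < (pathRatio r P * pathRatio r Q) ^ (s : ℝ) * (mwMatrix r s ^ n) a b := by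
          rwa [← inv_lt_iff_one_lt_mul₀' (by positivity)]
      _ = ∑ p ∈ pathFinset a n b, pathRatio r (P.comp (p.comp Q)) ^ (s : ℝ) :=
          (sum_pathRatio_comp_rpow hr0 s n P Q).symm
      _ = _ := (Finset.sum_coe_sort _ _).symm

end Attractor

end GraphIFS

open GraphIFS

theorem theorem3p14_general {V : Type*} [Fintype V] [DecidableEq V] [Quiver V]
    [∀ a b : V, Fintype (a ⟶ b)] (hconn : IsStronglyConnected V)
    {S : V → Type*} [∀ v, MetricSpace (S v)] [∀ v, Nontrivial (S v)]
    (f : ∀ ⦃a b : V⦄, (a ⟶ b) → S b → S a)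
    (r r' : ∀ ⦃a b : V⦄, (a ⟶ b) → ℝ)
    (hr : ∀ (a b : V) (e : a ⟶ b), r e < 1)
    (hr' : ∀ (a b : V) (e : a ⟶ b), 0 < r' e)
    (hupper : ∀ (a b : V) (e : a ⟶ b) (x y : S b), dist (f e x) (f e y) ≤ r e * dist x y)
    (hlower : ∀ (a b : V) (e : a ⟶ b) (x y : S b), r' e * dist x y ≤ dist (f e x) (f e y))
    (K : ∀ v, Set (S v)) (hK : IsAttractorList f K) (hU : StrongOpenSetCondition f K)
    (s₂ : ℝ) (hs₂ : IsMWDimension r' s₂) :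
    ∀ v, ENNReal.ofReal s₂ ≤ dimH (K v) := by
  intro v
  obtain ⟨R, hR0, hR1, hrR⟩ := exists_lt_one_forall_ratio_le hr
  have hf (a b : V) (e : a ⟶ b) : LipschitzWith R (f e) := .of_dist_le_mul fun x y =>
    (hupper a b e x y).trans (mul_le_mul_of_nonneg_right (hrR a b e) dist_nonneg)
  have hr'R (a b : V) (e : a ⟶ b) : r' e ≤ R := by
    obtain ⟨x, y, hxy⟩ := exists_pair_ne (S b)
    exact le_of_mul_le_mul_right
      ((hlower a b e x y).trans ((hf a b e).dist_le_mul x y)) (dist_pos.2 hxy)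
  refine ENNReal.le_of_forall_nnreal_lt fun s hs => ?_
  have hst : (s : ℝ) < s₂ := Real.lt_toNNReal_iff_coe_lt.1 (ENNReal.coe_lt_coe.1 hs)
  exact hK.le_dimH_of_lt hU hconn hR0 hR1 hf hr' hr'R hlower hs₂.2.ge hst v

theorem theorem3p14 {V : Type*} [Fintype V] [DecidableEq V] [Quiver V]
    [∀ a b : V, Fintype (a ⟶ b)] (hconn : Quiver.IsStronglyConnected V)
    {S : V → Type*} [∀ v, MetricSpace (S v)] [∀ v, CompleteSpace (S v)] [∀ v, Nontrivial (S v)]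
    (f : ∀ ⦃a b : V⦄, (a ⟶ b) → S b → S a)
    (r r' : ∀ ⦃a b : V⦄, (a ⟶ b) → ℝ)
    (hr : ∀ (a b : V) (e : a ⟶ b), r e < 1)
    (hr' : ∀ (a b : V) (e : a ⟶ b), 0 < r' e)
    (hupper : ∀ (a b : V) (e : a ⟶ b) (x y : S b), dist (f e x) (f e y) ≤ r e * dist x y)
    (hlower : ∀ (a b : V) (e : a ⟶ b) (x y : S b), r' e * dist x y ≤ dist (f e x) (f e y))
    (K : ∀ v, Set (S v)) (hK : GraphIFS.IsAttractorList f K)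
    (hU : GraphIFS.StrongOpenSetCondition f K)
    (s₂ : ℝ) (hs₂ : GraphIFS.IsMWDimension r' s₂) :
    ∀ v, ENNReal.ofReal s₂ ≤ dimH (K v) :=
  theorem3p14_general hconn f r r' hr hr' hupper hlower K hK hU s₂ hs₂
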